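/- Let $F$ be an arbitrary field and let $L$ be a finite-dimensional (left) Leibniz algebra over $F$, i.e. a finite-dimensional $F$-vector space with a bilinear multiplication satisfying $a(bc)=(ab)c+b(ac)$. Let $K$ be the algebraic closure of $F$. A subalgebra $S$ of $L$ is called left triangulable on $L$ if $K\otimes_F L$ has a $K$-basis with respect to which the matrices of all left multiplications by elements of $K\otimes_F S$ are upper triangular, and triangulable on $L$ if $K\otimes_F L$ has a $K$-basis with respect to which the matrices of all left multiplications and of all right multiplications by elements of $K\otimes_F S$ are upper triangular. Suppose that $L$ is solvable (its derived series $L,\ LL,\ (LL)(LL),\dots$ reaches $0$) and that every proper subalgebra of $L$ generated by two elements is left triangulable on $L$ (in particular, this holds if every such subalgebra is triangulable on $L$). Then $L$ is triangulable on itself, and $L$ is strongly solvable, i.e. the subalgebra $L^2=LL$ is nilpotent. -/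

import Mathlib

open scoped TensorProduct

/-- The (left) Leibniz identity: every left multiplication is a derivation.  A Leibniz algebra over
a field `F` is an `F`-vector space `L` with an `F`-bilinear multiplication (`NonUnitalNonAssocRing L`,
`IsScalarTower F L L`, `SMulCommClass F L L`) that satisfies this identity. -/
class IsLeftLeibniz (L : Type*) [NonUnitalNonAssocRing L] : Prop where
  leibniz : ∀ a b c : L, a * (b * c) = (a * b) * c + b * (a * c)

namespace Leibniz

section Series

variable (F : Type*) {L : Type*} [Field F] [NonUnitalNonAssocRing L] [Module F L]

/-- The product `PQ` of two subspaces: the span of all products `a * b`, `a ∈ P`, `b ∈ Q`. -/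
def prod (P Q : Submodule F L) : Submodule F L :=
  Submodule.span F {z | ∃ a ∈ P, ∃ b ∈ Q, a * b = z}

/-- The derived series `P, PP, (PP)(PP), …`. -/
def derivedSeries (P : Submodule F L) : ℕ → Submodule F L
  | 0 => P
  | n + 1 => prod F (derivedSeries P n) (derivedSeries P n)

/-- The lower central series `P, PP, P(PP), …` of (the subspace underlying) a subalgebra `P`. -/
def lowerCentralSeries (P : Submodule F L) : ℕ → Submodule F L
  | 0 => P
  | n + 1 => prod F P (lowerCentralSeries P n)

variable (L)

/-- `L` is solvable: its derived series reaches `0`. -/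
def IsSolvable : Prop := ∃ n, derivedSeries F (⊤ : Submodule F L) n = ⊥

/-- `L` is strongly solvable: `L² = LL` is nilpotent. -/
def IsStronglySolvable : Prop :=
  ∃ n, lowerCentralSeries F (prod F (⊤ : Submodule F L) ⊤) n = ⊥

end Series

section Triangulable

variable {F L : Type*} [Field F] [NonUnitalNonAssocRing L] [Module F L]
  [IsScalarTower F L L] [SMulCommClass F L L]

/-- A subalgebra generated by two (not necessarily distinct) elements. -/
def IsTwoGenerated (S : NonUnitalSubalgebra F L) : Prop :=
  ∃ x y : L, S = NonUnitalAlgebra.adjoin F {x, y}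

/-- `K ⊗ S` inside `K ⊗ L`, where `K` is the algebraic closure of `F`. -/
noncomputable def extend (S : NonUnitalSubalgebra F L) :
    Submodule (AlgebraicClosure F) (AlgebraicClosure F ⊗[F] L) :=
  S.toSubmodule.baseChange (AlgebraicClosure F)

/-- `S` is triangulable on `L`, where `L` is regarded as a left module over `S`: over the algebraic
closure `K` of `F`, the space `K ⊗ L` has a basis in which all left multiplications by elements of
`K ⊗ S` have upper triangular matrices. -/
def IsLeftTriangulable (S : NonUnitalSubalgebra F L) : Prop :=
  ∃ (n : ℕ) (b : Module.Basis (Fin n) (AlgebraicClosure F) (AlgebraicClosure F ⊗[F] L)),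
    ∀ x ∈ extend S,
      (LinearMap.toMatrix b b (LinearMap.mulLeft (AlgebraicClosure F) x)).BlockTriangular id

/-- `S` is triangulable on `L`, where `L` is regarded as a two-sided module over `S`: over the
algebraic closure `K` of `F`, the space `K ⊗ L` has a basis in which all left and all right
multiplications by elements of `K ⊗ S` have upper triangular matrices. -/
def IsTriangulable (S : NonUnitalSubalgebra F L) : Prop :=
  ∃ (n : ℕ) (b : Module.Basis (Fin n) (AlgebraicClosure F) (AlgebraicClosure F ⊗[F] L)),
    ∀ x ∈ extend S,
      (LinearMap.toMatrix b b (LinearMap.mulLeft (AlgebraicClosure F) x)).BlockTriangular id ∧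
      (LinearMap.toMatrix b b (LinearMap.mulRight (AlgebraicClosure F) x)).BlockTriangular id

theorem IsTriangulable.isLeftTriangulable {S : NonUnitalSubalgebra F L}
    (h : IsTriangulable S) : IsLeftTriangulable S := by
  obtain ⟨n, b, hb⟩ := h
  exact ⟨n, b, fun x hx => (hb x hx).1⟩

end Triangulable

end Leibniz

/-! Write `L_a`, `R_a` for the multiplications on `K ⊗ L`, and `L⁽ⁱ⁾` for the derived series. The
crux is that every `L_{xy}` is nilpotent (`isNilpotent_leftOp_mul`). If `x`, `y` generate a proper
subalgebra, `L_{xy}` is a commutator of triangular matrices. This covers all pairs in `L⁽¹⁾`, a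
proper subalgebra unless `L = 0`. In general take the Fitting decomposition of `L` under left
multiplication by `z = xy`: the null component is a subalgebra, and the other component lies in
`L⁽²⁾`. If the null component is proper, then modulo left operators from `L⁽²⁾` one may replace `x`,
`y` by their null components `x₀`, `y₀`, which generate a proper subalgebra. Nilpotency passes from
single operators to sums by an Engel argument up the derived series: `[L_a, L_b] = L_{ab}`, so each
set of operators has its commutators in the preceding one. Once all `L_{ab}` form an Engel set, `L²`
acts strictly triangularly, which gives strong solvability. On vectors killed by the `L_{ab}`, the
left multiplications commute, so they have common eigenvectors. The identity `R_b (R_a + L_a) = 0`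
then brings in the right multiplications. -/

namespace Leibniz

/-! ### Engel and Lie type theorems for sets of operators -/

section Operators

variable {k V : Type*} [Field k] [AddCommGroup V] [Module k V]

/-- Every nonzero subquotient `U / W` of `V` invariant under `S` contains a nonzero vector that is
annihilated by `S`. -/
def IsEngelSet (S : Set (Module.End k V)) : Prop :=
  ∀ W U : Submodule k V, W < U → (∀ T ∈ S, ∀ v ∈ W, T v ∈ W) → (∀ T ∈ S, ∀ v ∈ U, T v ∈ U) →
    ∃ v ∈ U, v ∉ W ∧ ∀ T ∈ S, T v ∈ W

/-- Every nonzero subquotient `U / W` of `V` invariant under `S` contains a common eigenvector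
of `S`. -/
def HasCommonEigenvectors (S : Set (Module.End k V)) : Prop :=
  ∀ W U : Submodule k V, W < U → (∀ T ∈ S, ∀ v ∈ W, T v ∈ W) → (∀ T ∈ S, ∀ v ∈ U, T v ∈ U) →
    ∃ v ∈ U, v ∉ W ∧ ∀ T ∈ S, ∃ c : k, T v - c • v ∈ W

theorem exists_annihilated_mod_of_isNilpotent {T : Module.End k V} (hT : IsNilpotent T)
    {W U : Submodule k V} (hWU : W < U) (hU : ∀ v ∈ U, T v ∈ U) :
    ∃ v ∈ U, v ∉ W ∧ T v ∈ W := by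
  obtain ⟨u, huU, huW⟩ := SetLike.exists_of_lt hWU
  obtain ⟨n, hn⟩ := hT
  have hex : ∃ m, (T ^ m) u ∈ W := ⟨n, by simp [hn]⟩
  classical
  have hU' : ∀ m, (T ^ m) u ∈ U := by
    intro m
    induction m with
    | zero => simpa using huU
    | succ m ih => rw [pow_succ', Module.End.mul_apply]; exact hU _ ih
  have hpos : Nat.find hex ≠ 0 := by
    intro h
    have := Nat.find_spec hex
    rw [h] at this
    exact huW (by simpa using this)
  obtain ⟨m, hm⟩ := Nat.exists_eq_succ_of_ne_zero hpos
  refine ⟨(T ^ m) u, hU' m, Nat.find_min hex (by omega), ?_⟩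
  have := Nat.find_spec hex
  rwa [hm, Nat.succ_eq_add_one, pow_succ', Module.End.mul_apply] at this

theorem exists_eigenvector_mod [IsAlgClosed k] [FiniteDimensional k V] (T : Module.End k V)
    {W U : Submodule k V} (hWU : W < U) (hW : ∀ v ∈ W, T v ∈ W) (hU : ∀ v ∈ U, T v ∈ U) :
    ∃ c : k, ∃ v ∈ U, v ∉ W ∧ T v - c • v ∈ W := by
  let T' : Module.End k U := T.restrict hU
  let W' : Submodule k U := W.comap U.subtype
  have hW' : W' ≤ W'.comap T' := fun v hv => hW _ hv
  have hne : W' ≠ ⊤ := by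
    obtain ⟨u, huU, huW⟩ := SetLike.exists_of_lt hWU
    intro h
    have : (⟨u, huU⟩ : U) ∈ W' := h ▸ Submodule.mem_top
    exact huW this
  have : Nontrivial (U ⧸ W') := Submodule.Quotient.nontrivial_iff.2 hne
  obtain ⟨c, hc⟩ := Module.End.exists_eigenvalue (W'.mapQ W' T' hW')
  obtain ⟨q, hq, hq0⟩ := hc.exists_hasEigenvector
  rw [Module.End.mem_eigenspace_iff] at hq
  obtain ⟨u, rfl⟩ := Submodule.Quotient.mk_surjective _ q
  refine ⟨c, u, u.2, ?_, ?_⟩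
  · intro h
    exact hq0 ((Submodule.Quotient.mk_eq_zero _).2 h)
  · rw [Submodule.mapQ_apply, ← Submodule.Quotient.mk_smul, Submodule.Quotient.eq] at hq
    exact hq

/-- Operators that commute modulo `W` and have one by one eigenvectors in the invariant subquotients
of `U / W`, with eigenvalues in `C`, have a common one. -/
theorem exists_common_eigenvector_mod [FiniteDimensional k V] (C : Set k)
    (S : Set (Module.End k V)) {W U : Submodule k V} (hWU : W < U)
    (hW : ∀ T ∈ S, ∀ v ∈ W, T v ∈ W) (hU : ∀ T ∈ S, ∀ v ∈ U, T v ∈ U)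
    (hcomm : ∀ T ∈ S, ∀ T' ∈ S, ∀ v ∈ U, T (T' v) - T' (T v) ∈ W)
    (heig : ∀ T ∈ S, ∀ U' : Submodule k V, W < U' → (∀ v ∈ U', T v ∈ U') →
      ∃ c ∈ C, ∃ v ∈ U', v ∉ W ∧ T v - c • v ∈ W) :
    ∃ v ∈ U, v ∉ W ∧ ∀ T ∈ S, ∃ c ∈ C, T v - c • v ∈ W := by
  -- In a minimal invariant `M` above `W`, each eigenspace modulo `W` is again invariant, hence is
  -- all of `M`; so any vector of `M` outside `W` works.
  obtain ⟨M, ⟨hWM, hMU, hM⟩, hmin⟩ := (wellFounded_lt (α := Submodule k V)).has_min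
    {M | W < M ∧ M ≤ U ∧ ∀ T ∈ S, ∀ v ∈ M, T v ∈ M} ⟨U, hWU, le_rfl, hU⟩
  obtain ⟨v, hvM, hvW⟩ := SetLike.exists_of_lt hWM
  refine ⟨v, hMU hvM, hvW, fun T hT => ?_⟩
  obtain ⟨c, hcC, u, huM, huW, hu⟩ := heig T hT M hWM (hM T hT)
  refine ⟨c, hcC, ?_⟩
  let M' : Submodule k V := M ⊓ W.comap (T - c • LinearMap.id)
  have hmem : ∀ w, w ∈ M' ↔ w ∈ M ∧ T w - c • w ∈ W := fun w => Iff.rfl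
  have hWM' : W < M' := by
    refine lt_of_le_of_ne (fun w hw => (hmem w).2 ⟨hWM.le hw, ?_⟩) ?_
    · exact W.sub_mem (hW T hT w hw) (W.smul_mem c hw)
    · intro h
      exact huW (h ▸ (hmem u).2 ⟨huM, hu⟩)
  have hM' : ∀ T' ∈ S, ∀ w ∈ M', T' w ∈ M' := by
    intro T' hT' w hw
    obtain ⟨hwM, hw⟩ := (hmem w).1 hw
    refine (hmem _).2 ⟨hM T' hT' w hwM, ?_⟩
    have h1 := hcomm T hT T' hT' w (hMU hwM)
    have h2 := hW T' hT' _ hw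
    rw [map_sub, map_smul] at h2
    simpa using W.add_mem h1 h2
  have hnot := hmin M' ⟨hWM', inf_le_left.trans hMU, hM'⟩
  have heq : M' = M := eq_of_le_of_not_lt inf_le_left hnot
  exact ((hmem v).1 (heq ▸ hvM)).2

/-- `U'` consists of the vectors of `U` that `D` sends into `W`. It is `S`-invariant because `[D, S]
⊆ D`, and `S` commutes on it modulo `W` because `[S, S] ⊆ D`. -/
theorem IsEngelSet.exists_annihilated_subspace {S D : Set (Module.End k V)} (hD : IsEngelSet D)
    (hDS : D ⊆ S) (hcomm : ∀ T ∈ S, ∀ T' ∈ S, T * T' - T' * T ∈ D)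
    {W U : Submodule k V} (hWU : W < U)
    (hW : ∀ T ∈ S, ∀ v ∈ W, T v ∈ W) (hU : ∀ T ∈ S, ∀ v ∈ U, T v ∈ U) :
    ∃ U' : Submodule k V, W < U' ∧ U' ≤ U ∧ (∀ T ∈ S, ∀ v ∈ U', T v ∈ U') ∧
      ∀ T ∈ S, ∀ T' ∈ S, ∀ v ∈ U', T (T' v) - T' (T v) ∈ W := by
  let U' : Submodule k V := U ⊓ ⨅ T ∈ D, W.comap T
  have hmem : ∀ w, w ∈ U' ↔ w ∈ U ∧ ∀ T ∈ D, T w ∈ W := by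
    intro w
    simp [U', Submodule.mem_iInf]
  obtain ⟨v, hvU, hvW, hv⟩ := hD W U hWU (fun T hT => hW T (hDS hT)) (fun T hT => hU T (hDS hT))
  refine ⟨U', lt_of_le_of_ne (fun w hw => (hmem w).2 ⟨hWU.le hw, fun T hT => hW T (hDS hT) w hw⟩)
    fun h => hvW (h ▸ (hmem v).2 ⟨hvU, hv⟩), inf_le_left, fun T hT w hw => ?_,
    fun T hT T' hT' w hw => ((hmem w).1 hw).2 _ (hcomm T hT T' hT')⟩
  obtain ⟨hwU, hw⟩ := (hmem w).1 hw
  refine (hmem _).2 ⟨hU T hT w hwU, fun T' hT' => ?_⟩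
  have h1 := hw _ (hcomm T' (hDS hT') T hT)
  have h2 := hW T hT _ (hw T' hT')
  simpa using W.add_mem h1 h2

theorem IsEngelSet.of_isNilpotent [FiniteDimensional k V] {S D : Set (Module.End k V)}
    (hD : IsEngelSet D) (hDS : D ⊆ S) (hcomm : ∀ T ∈ S, ∀ T' ∈ S, T * T' - T' * T ∈ D)
    (hnil : ∀ T ∈ S, IsNilpotent T) : IsEngelSet S := by
  intro W U hWU hW hU
  obtain ⟨U', hWU', hU'U, hU', hc⟩ := hD.exists_annihilated_subspace hDS hcomm hWU hW hU
  obtain ⟨v, hvU, hvW, hv⟩ := exists_common_eigenvector_mod {0} S hWU' hW hU' hc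
    (fun T hT M hWM hM => by
      obtain ⟨v, hv, hvW, h⟩ := exists_annihilated_mod_of_isNilpotent (hnil T hT) hWM hM
      exact ⟨0, rfl, v, hv, hvW, by simpa using h⟩)
  refine ⟨v, hU'U hvU, hvW, fun T hT => ?_⟩
  obtain ⟨c, rfl, h⟩ := hv T hT
  simpa using h

theorem IsEngelSet.hasCommonEigenvectors [IsAlgClosed k] [FiniteDimensional k V]
    {S D : Set (Module.End k V)} (hD : IsEngelSet D) (hDS : D ⊆ S)
    (hcomm : ∀ T ∈ S, ∀ T' ∈ S, T * T' - T' * T ∈ D) : HasCommonEigenvectors S := by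
  intro W U hWU hW hU
  obtain ⟨U', hWU', hU'U, hU', hc⟩ := hD.exists_annihilated_subspace hDS hcomm hWU hW hU
  obtain ⟨v, hvU, hvW, hv⟩ := exists_common_eigenvector_mod Set.univ S hWU' hW hU' hc
    (fun T hT M hWM hM => by
      obtain ⟨c, h⟩ := exists_eigenvector_mod T hWM (hW T hT) hM
      exact ⟨c, trivial, h⟩)
  refine ⟨v, hU'U hvU, hvW, fun T hT => ?_⟩
  obtain ⟨c, -, h⟩ := hv T hT
  exact ⟨c, h⟩

/-- `W (i + 1)` is the largest subspace sent into `W i`; the Engel property prevents the chain from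
stabilizing below `⊤`. -/
theorem IsEngelSet.exists_filtration [FiniteDimensional k V] {S : Set (Module.End k V)}
    (hS : IsEngelSet S) : ∃ (n : ℕ) (W : ℕ → Submodule k V), W 0 = ⊥ ∧ W n = ⊤ ∧
      ∀ i, ∀ T ∈ S, ∀ v ∈ W (i + 1), T v ∈ W i := by
  obtain ⟨W, h0, hsucc⟩ : ∃ W : ℕ → Submodule k V, W 0 = ⊥ ∧
      ∀ i v, v ∈ W (i + 1) ↔ ∀ T ∈ S, T v ∈ W i := by
    refine ⟨fun n => (fun X => ⨅ T ∈ S, X.comap T)^[n] ⊥, rfl, fun i v => ?_⟩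
    simp only [Function.iterate_succ_apply', Submodule.mem_iInf, Submodule.mem_comap]
  have hmono : Monotone W := by
    refine monotone_nat_of_le_succ fun n => ?_
    induction n with
    | zero => exact h0 ▸ bot_le
    | succ n ih => exact fun v hv => (hsucc _ v).2 fun T hT => ih ((hsucc n v).1 hv T hT)
  obtain ⟨n, hn⟩ := monotone_stabilizes_iff_noetherian.2 (inferInstance : IsNoetherian k V) ⟨W, hmono⟩
  refine ⟨n, W, h0, ?_, fun i T hT v hv => (hsucc i v).1 hv T hT⟩
  by_contra hne
  obtain ⟨v, -, hv, h⟩ := hS (W n) ⊤ (lt_top_iff_ne_top.2 hne)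
    (fun T hT v hv => (hsucc n v).1 (hmono n.le_succ hv) T hT) (fun _ _ _ _ => Submodule.mem_top)
  have := hn (n + 1) n.le_succ
  exact hv ((show W n = W (n + 1) from this) ▸ (hsucc n v).2 h)

theorem IsEngelSet.isNilpotent_of_mem_span [FiniteDimensional k V] {S : Set (Module.End k V)}
    (hS : IsEngelSet S) {T : Module.End k V} (hT : T ∈ Submodule.span k S) : IsNilpotent T := by
  obtain ⟨n, W, h0, hn, hW⟩ := hS.exists_filtration
  have hT' : ∀ i, ∀ v ∈ W (i + 1), T v ∈ W i := by
    intro i v hv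
    induction hT using Submodule.span_induction with
    | mem T hT => exact hW i T hT v hv
    | zero => exact (W i).zero_mem
    | add A B _ _ hA hB => exact (W i).add_mem hA hB
    | smul c A _ hA => exact (W i).smul_mem c hA
  have hpow : ∀ i, ∀ v ∈ W i, (T ^ i) v = 0 := by
    intro i
    induction i with
    | zero => intro v hv; simpa [h0] using hv
    | succ i ih => intro v hv; rw [pow_succ, Module.End.mul_apply]; exact ih _ (hT' i v hv)
  exact ⟨n, LinearMap.ext fun v => hpow n v (hn ▸ Submodule.mem_top)⟩

theorem isEngelSet_of_subset_zero {S : Set (Module.End k V)} (hS : S ⊆ {0}) : IsEngelSet S := by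
  intro W U hWU _ _
  obtain ⟨v, hvU, hvW⟩ := SetLike.exists_of_lt hWU
  refine ⟨v, hvU, hvW, fun T hT => ?_⟩
  rw [hS hT]
  exact W.zero_mem

theorem HasCommonEigenvectors.exists_basis [FiniteDimensional k V] {S : Set (Module.End k V)}
    (hS : HasCommonEigenvectors S) :
    ∃ b : Module.Basis (Fin (Module.finrank k V)) k V,
      ∀ T ∈ S, ∀ j, T (b j) ∈ Submodule.span k (b '' Set.Iic j) := by
  have key : ∀ m ≤ Module.finrank k V, ∃ v : Fin m → V, LinearIndependent k v ∧
      ∀ T ∈ S, ∀ j, T (v j) ∈ Submodule.span k (v '' Set.Iic j) := by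
    intro m
    induction m with
    | zero => exact fun _ => ⟨Fin.elim0, linearIndependent_empty_type, fun _ _ j => j.elim0⟩
    | succ m ih =>
      intro hm
      obtain ⟨v, hv, htri⟩ := ih (by omega)
      set W := Submodule.span k (Set.range v) with hWdef
      have hWtop : W < ⊤ := by
        refine lt_top_iff_ne_top.2 fun h => ?_
        have h1 : Module.finrank k W = m := by
          rw [hWdef, finrank_span_eq_card hv, Fintype.card_fin]
        rw [h, finrank_top] at h1
        omega
      have hW : ∀ T ∈ S, ∀ w ∈ W, T w ∈ W := by
        intro T hT w hw
        induction hw using Submodule.span_induction with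
        | mem w hw =>
          obtain ⟨j, rfl⟩ := hw
          exact Submodule.span_mono (Set.image_subset_range _ _) (htri T hT j)
        | zero => simp
        | add a b _ _ ha hb => rw [map_add]; exact W.add_mem ha hb
        | smul c a _ ha => rw [map_smul]; exact W.smul_mem c ha
      obtain ⟨u, -, huW, hu⟩ := hS W ⊤ hWtop hW fun _ _ _ _ => Submodule.mem_top
      refine ⟨Fin.snoc v u, linearIndependent_finSnoc.2 ⟨hv, huW⟩, fun T hT j => ?_⟩
      refine Fin.lastCases ?_ (fun j => ?_) j
      · obtain ⟨c, hc⟩ := hu T hT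
        have hWle : W ≤ Submodule.span k
            ((Fin.snoc v u : Fin (m + 1) → V) '' Set.Iic (Fin.last m)) := by
          refine Submodule.span_mono ?_
          rintro _ ⟨i, rfl⟩
          exact ⟨i.castSucc, Fin.le_last _, by simp⟩
        have hmem : u ∈ Submodule.span k
            ((Fin.snoc v u : Fin (m + 1) → V) '' Set.Iic (Fin.last m)) :=
          Submodule.subset_span ⟨Fin.last m, le_refl (Fin.last m), by simp⟩
        have := Submodule.add_mem _ (hWle hc) (Submodule.smul_mem _ c hmem)
        simpa using this
      · rw [Fin.snoc_castSucc]
        refine Submodule.span_mono ?_ (htri T hT j)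
        rintro _ ⟨i, hi, rfl⟩
        exact ⟨i.castSucc, by simpa using hi, by simp⟩
  obtain ⟨v, hv, htri⟩ := key _ le_rfl
  rcases Nat.eq_zero_or_pos (Module.finrank k V) with h0 | hpos
  · refine ⟨Module.finBasis k V, fun T _ j => ?_⟩
    exact absurd j.2 (by omega)
  · have : Nonempty (Fin (Module.finrank k V)) := ⟨⟨0, hpos⟩⟩
    refine ⟨basisOfLinearIndependentOfCardEqFinrank hv (by simp), fun T hT j => ?_⟩
    simpa using htri T hT j

theorem blockTriangular_toMatrix_iff {n : ℕ} (b : Module.Basis (Fin n) k V)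
    (T : Module.End k V) : (LinearMap.toMatrix b b T).BlockTriangular id ↔
      ∀ j, T (b j) ∈ Submodule.span k (b '' Set.Iic j) := by
  simp only [Module.Basis.mem_span_image, Matrix.BlockTriangular, LinearMap.toMatrix_apply, id]
  constructor
  · intro h j i hi
    by_contra hij
    exact (Finsupp.mem_support_iff.1 hi) (h (not_le.1 hij))
  · intro h i j hij
    by_contra hne
    exact absurd (h j (Finsupp.mem_support_iff.2 hne)) (not_le.2 hij)

theorem mul_apply_self_of_blockTriangular {n : ℕ} {A B : Matrix (Fin n) (Fin n) k}
    (hA : A.BlockTriangular id) (hB : B.BlockTriangular id) (i : Fin n) :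
    (A * B) i i = A i i * B i i := by
  rw [Matrix.mul_apply, Finset.sum_eq_single i]
  · intro j _ hj
    rcases lt_or_gt_of_ne hj with h | h
    · rw [hA h, zero_mul]
    · rw [hB h, mul_zero]
  · simp

/-- The diagonals of `AB` and `BA` agree, so the commutator has characteristic polynomial `X ^ n`,
and Cayley–Hamilton applies. -/
theorem isNilpotent_commutator_of_blockTriangular {n : ℕ} (b : Module.Basis (Fin n) k V)
    {A B : Module.End k V} (hA : (LinearMap.toMatrix b b A).BlockTriangular id)
    (hB : (LinearMap.toMatrix b b B).BlockTriangular id) : IsNilpotent (A * B - B * A) := by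
  set M := LinearMap.toMatrix b b (A * B - B * A) with hM
  have hM' : M = LinearMap.toMatrix b b A * LinearMap.toMatrix b b B -
      LinearMap.toMatrix b b B * LinearMap.toMatrix b b A := by
    rw [hM, map_sub, LinearMap.toMatrix_mul, LinearMap.toMatrix_mul]
  have htri : M.BlockTriangular id := hM' ▸ (hA.mul hB).sub (hB.mul hA)
  have hdiag : ∀ i, M i i = 0 := by
    intro i
    rw [hM', Matrix.sub_apply, mul_apply_self_of_blockTriangular hA hB,
      mul_apply_self_of_blockTriangular hB hA, mul_comm, sub_self]
  have hpow : M ^ n = 0 := by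
    have h1 := Matrix.aeval_self_charpoly M
    rw [Matrix.charpoly_of_isUpperTriangular M htri] at h1
    simpa [hdiag] using h1
  refine ⟨n, (LinearMap.toMatrixAlgEquiv b).injective ?_⟩
  rw [map_pow, map_zero]
  exact hpow

end Operators

/-! ### Products of subspaces and the derived series -/

section Subspaces

variable {F L : Type*} [Field F] [NonUnitalNonAssocRing L] [Module F L]

theorem mul_mem_prod {P Q : Submodule F L} {a b : L} (ha : a ∈ P) (hb : b ∈ Q) :
    a * b ∈ prod F P Q :=
  Submodule.subset_span ⟨a, ha, b, hb, rfl⟩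

theorem prod_mono {P P' Q Q' : Submodule F L} (hP : P ≤ P') (hQ : Q ≤ Q') :
    prod F P Q ≤ prod F P' Q' := by
  refine Submodule.span_mono ?_
  rintro _ ⟨a, ha, b, hb, rfl⟩
  exact ⟨a, hP ha, b, hQ hb, rfl⟩

theorem derivedSeries_succ_le (n : ℕ) :
    derivedSeries F (⊤ : Submodule F L) (n + 1) ≤ derivedSeries F ⊤ n := by
  induction n with
  | zero => exact le_top
  | succ n ih => exact prod_mono ih ih

theorem top_eq_bot_of_isSolvable (hsol : IsSolvable F L)
    (h : derivedSeries F (⊤ : Submodule F L) 1 = ⊤) : (⊤ : Submodule F L) = ⊥ := by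
  obtain ⟨n, hn⟩ := hsol
  rw [← hn]
  clear hn
  induction n with
  | zero => rfl
  | succ n ih => rw [derivedSeries, ← ih]; exact h.symm

/-- Left multiplications are derivations, so they preserve products of `L⁽¹⁾` with itself. -/
theorem mul_mem_derivedSeries_two [IsLeftLeibniz L] [SMulCommClass F L L] (a : L) {b : L}
    (hb : b ∈ derivedSeries F (⊤ : Submodule F L) 2) :
    a * b ∈ derivedSeries F (⊤ : Submodule F L) 2 := by
  have h1 : ∀ u v : L, u * v ∈ derivedSeries F (⊤ : Submodule F L) 1 :=
    fun u v => mul_mem_prod Submodule.mem_top Submodule.mem_top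
  change b ∈ Submodule.span F _ at hb
  induction hb using Submodule.span_induction with
  | mem z hz =>
    obtain ⟨c, hc, d, hd, rfl⟩ := hz
    rw [IsLeftLeibniz.leibniz]
    exact Submodule.add_mem _ (mul_mem_prod (h1 a c) hd) (mul_mem_prod hc (h1 a d))
  | zero => rw [mul_zero]; exact Submodule.zero_mem _
  | add u v _ _ hu hv => rw [mul_add]; exact Submodule.add_mem _ hu hv
  | smul c u _ hu => rw [mul_smul_comm]; exact Submodule.smul_mem _ c hu

end Subspaces

/-! ### Fitting decomposition for a left multiplication -/

section Fitting

variable (F : Type*) {L : Type*} [Field F] [NonUnitalNonAssocRing L] [Module F L]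
  [SMulCommClass F L L] [IsLeftLeibniz L]

theorem mulLeft_pow_add_apply_mul (z : L) : ∀ (i j : ℕ) (a b : L),
    (LinearMap.mulLeft F z ^ i) a = 0 → (LinearMap.mulLeft F z ^ j) b = 0 →
      (LinearMap.mulLeft F z ^ (i + j)) (a * b) = 0
  | 0, j, a, b, ha, _ => by
    have ha : a = 0 := by simpa using ha
    rw [ha, zero_mul, map_zero]
  | i + 1, 0, a, b, _, hb => by
    have hb : b = 0 := by simpa using hb
    rw [hb, mul_zero, map_zero]
  | i + 1, j + 1, a, b, ha, hb => by
    have ha' := ha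
    have hb' := hb
    rw [pow_succ, Module.End.mul_apply, LinearMap.mulLeft_apply] at ha' hb'
    have h1 := mulLeft_pow_add_apply_mul z i (j + 1) (z * a) b ha' hb
    have h2 := mulLeft_pow_add_apply_mul z (i + 1) j a (z * b) ha hb'
    rw [show i + 1 + (j + 1) = i + (j + 1) + 1 by omega, pow_succ, Module.End.mul_apply,
      LinearMap.mulLeft_apply, IsLeftLeibniz.leibniz, map_add, h1, zero_add,
      show i + (j + 1) = i + 1 + j by omega, h2]

/-- The elements of `L` annihilated by some power of the left multiplication by `z`. -/
def engelSubalgebra (z : L) : NonUnitalSubalgebra F L where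
  carrier := {a | ∃ n, (LinearMap.mulLeft F z ^ n) a = 0}
  zero_mem' := ⟨0, map_zero _⟩
  add_mem' := by
    rintro a b ⟨m, hm⟩ ⟨n, hn⟩
    refine ⟨m + n, ?_⟩
    rw [map_add]
    nth_rw 1 [add_comm m n]
    rw [pow_add, pow_add, Module.End.mul_apply, Module.End.mul_apply, hm, hn]
    simp
  smul_mem' := by
    rintro c a ⟨n, hn⟩
    exact ⟨n, by rw [map_smul, hn, smul_zero]⟩
  mul_mem' := by
    rintro a b ⟨m, hm⟩ ⟨n, hn⟩
    exact ⟨m + n, mulLeft_pow_add_apply_mul F z m n a b hm hn⟩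

variable [FiniteDimensional F L]

theorem isNilpotent_mulLeft_of_engelSubalgebra_eq_top [IsScalarTower F L L] {z : L}
    (h : engelSubalgebra F z = ⊤) : IsNilpotent (LinearMap.mulLeft F z) := by
  rw [Module.End.isNilpotent_iff_of_finite]
  intro a
  have ha : a ∈ engelSubalgebra F z := h ▸ trivial
  exact ha

theorem exists_add_mem_engelSubalgebra {z : L}
    (hz : z ∈ derivedSeries F (⊤ : Submodule F L) 1) (x : L) :
    ∃ x₀ ∈ engelSubalgebra F z, ∃ x₁ ∈ derivedSeries F (⊤ : Submodule F L) 2, x₀ + x₁ = x := by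
  obtain ⟨n, hn, hn2⟩ := ((LinearMap.eventually_isCompl_ker_pow_range_pow
    (LinearMap.mulLeft F z)).and (Filter.eventually_ge_atTop 2)).exists
  -- The bound `2 ≤ n` puts the range inside `L⁽²⁾`: in `z (z u)` both `z` and `z u` lie in `L⁽¹⁾`.
  have hx : x ∈ LinearMap.ker (LinearMap.mulLeft F z ^ n) ⊔
      LinearMap.range (LinearMap.mulLeft F z ^ n) := hn.sup_eq_top ▸ Submodule.mem_top
  obtain ⟨x₀, h0, _, ⟨u, rfl⟩, h⟩ := Submodule.mem_sup.1 hx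
  refine ⟨x₀, ⟨n, h0⟩, _, ?_, h⟩
  obtain ⟨m, rfl⟩ := Nat.exists_eq_add_of_le' hn2
  rw [pow_succ', pow_succ', Module.End.mul_apply, Module.End.mul_apply, LinearMap.mulLeft_apply,
    LinearMap.mulLeft_apply]
  exact mul_mem_prod hz (mul_mem_prod Submodule.mem_top Submodule.mem_top)

end Fitting

/-! ### Multiplication operators over the algebraic closure -/

section Extension

variable (F : Type*) {L : Type*} [Field F] [NonUnitalNonAssocRing L] [Module F L]
  [IsScalarTower F L L] [SMulCommClass F L L]

/-- The extension to `K ⊗ L` of the left multiplication by an element of `L`. -/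
noncomputable def leftOp (a : L) :
    Module.End (AlgebraicClosure F) (AlgebraicClosure F ⊗[F] L) :=
  LinearMap.mulLeft (AlgebraicClosure F) (1 ⊗ₜ[F] a)

/-- The extension to `K ⊗ L` of the right multiplication by an element of `L`. -/
noncomputable def rightOp (a : L) :
    Module.End (AlgebraicClosure F) (AlgebraicClosure F ⊗[F] L) :=
  LinearMap.mulRight (AlgebraicClosure F) (1 ⊗ₜ[F] a)

@[simp]
theorem leftOp_tmul (a : L) (c : AlgebraicClosure F) (b : L) :
    leftOp F a (c ⊗ₜ[F] b) = c ⊗ₜ[F] (a * b) := by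
  rw [leftOp, LinearMap.mulLeft_apply, Algebra.TensorProduct.tmul_mul_tmul, one_mul]

@[simp]
theorem rightOp_tmul (a : L) (c : AlgebraicClosure F) (b : L) :
    rightOp F a (c ⊗ₜ[F] b) = c ⊗ₜ[F] (b * a) := by
  rw [rightOp, LinearMap.mulRight_apply, Algebra.TensorProduct.tmul_mul_tmul, mul_one]

theorem leftOp_eq_baseChange (a : L) :
    leftOp F a = (LinearMap.mulLeft F a).baseChange (AlgebraicClosure F) := by
  refine TensorProduct.AlgebraTensorModule.curry_injective ?_
  ext b
  simp

theorem leftOp_zero : leftOp F (0 : L) = 0 := by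
  rw [leftOp, TensorProduct.tmul_zero, LinearMap.mulLeft_zero_eq_zero]

theorem leftOp_add (a b : L) : leftOp F (a + b) = leftOp F a + leftOp F b := by
  refine TensorProduct.AlgebraTensorModule.curry_injective ?_
  ext c
  simp [add_mul, TensorProduct.tmul_add]

theorem leftOp_smul (c : F) (a : L) :
    leftOp F (c • a) = algebraMap F (AlgebraicClosure F) c • leftOp F a := by
  refine TensorProduct.AlgebraTensorModule.curry_injective ?_
  ext b
  simp [smul_mul_assoc]

theorem leftOp_mem_span {T : Set L} {a : L} (ha : a ∈ Submodule.span F T) :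
    leftOp F a ∈ Submodule.span (AlgebraicClosure F) (leftOp F '' T) := by
  induction ha using Submodule.span_induction with
  | mem a ha => exact Submodule.subset_span ⟨a, ha, rfl⟩
  | zero => rw [leftOp_zero]; exact Submodule.zero_mem _
  | add a b _ _ ha hb => rw [leftOp_add]; exact Submodule.add_mem _ ha hb
  | smul c a _ ha => rw [leftOp_smul]; exact Submodule.smul_mem _ _ ha

/-- The operators `leftOp F (a * b)` with `a` and `b` in `P`. -/
def leftOpProducts (P : Submodule F L) :
    Set (Module.End (AlgebraicClosure F) (AlgebraicClosure F ⊗[F] L)) :=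
  leftOp F '' {z | ∃ a ∈ P, ∃ b ∈ P, a * b = z}

variable {F}

theorem leftOp_mul_mem {P : Submodule F L} {a b : L} (ha : a ∈ P) (hb : b ∈ P) :
    leftOp F (a * b) ∈ leftOpProducts F P :=
  ⟨_, ⟨a, ha, b, hb, rfl⟩, rfl⟩

theorem leftOpProducts_mono {P Q : Submodule F L} (h : P ≤ Q) :
    leftOpProducts F P ⊆ leftOpProducts F Q := by
  rintro _ ⟨_, ⟨a, ha, b, hb, rfl⟩, rfl⟩
  exact leftOp_mul_mem (h ha) (h hb)

variable [IsLeftLeibniz L]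

theorem leftOp_mul (a b : L) :
    leftOp F (a * b) = leftOp F a * leftOp F b - leftOp F b * leftOp F a := by
  refine TensorProduct.AlgebraTensorModule.curry_injective ?_
  ext c
  simp [IsLeftLeibniz.leibniz a b c, TensorProduct.tmul_add]

/-- Comparing the Leibniz identity for `a, b` and for `b, a` gives `(ab + ba) c = 0`. -/
theorem leftOp_mul_swap (a b : L) : leftOp F (a * b) = leftOp F (-(b * a)) := by
  refine TensorProduct.AlgebraTensorModule.curry_injective ?_
  ext c
  have h1 := IsLeftLeibniz.leibniz a b c
  rw [IsLeftLeibniz.leibniz b a c, ← add_assoc] at h1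
  have h : a * b * c = -(b * a) * c := by
    rw [neg_mul]
    exact eq_neg_of_add_eq_zero_left (right_eq_add.1 h1)
  simp [h]

theorem rightOp_mul (a b : L) :
    rightOp F (a * b) = leftOp F a * rightOp F b - rightOp F b * leftOp F a := by
  refine TensorProduct.AlgebraTensorModule.curry_injective ?_
  ext c
  simp [IsLeftLeibniz.leibniz a c b, TensorProduct.tmul_add]

theorem rightOp_mul_rightOp_add_leftOp (a b : L) :
    rightOp F b * (rightOp F a + leftOp F a) = 0 := by
  refine TensorProduct.AlgebraTensorModule.curry_injective ?_
  ext c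
  have h1 := IsLeftLeibniz.leibniz a c b
  have h2 := IsLeftLeibniz.leibniz c a b
  have h : (c * a + a * c) * b = 0 := by
    rw [h1, ← add_assoc, ← add_mul] at h2
    exact right_eq_add.1 h2
  simp [← TensorProduct.tmul_add, h]

theorem isNilpotent_leftOp_mul_of_isLeftTriangulable {S : NonUnitalSubalgebra F L}
    (hS : IsLeftTriangulable S) {a b : L} (ha : a ∈ S) (hb : b ∈ S) :
    IsNilpotent (leftOp F (a * b)) := by
  obtain ⟨n, e, he⟩ := hS
  rw [leftOp_mul]
  exact isNilpotent_commutator_of_blockTriangular e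
    (he _ (Submodule.tmul_mem_baseChange_of_mem _ ha))
    (he _ (Submodule.tmul_mem_baseChange_of_mem _ hb))

end Extension

/-! ### Nilpotency of products, strong solvability and triangulation -/

section Main

variable {F L : Type*} [Field F] [NonUnitalNonAssocRing L] [Module F L]
  [IsScalarTower F L L] [SMulCommClass F L L] [IsLeftLeibniz L] [FiniteDimensional F L]

omit [FiniteDimensional F L] in
theorem commutator_mem_leftOpProducts {P : Submodule F L} :
    ∀ T ∈ leftOpProducts F P, ∀ T' ∈ leftOpProducts F P,
      T * T' - T' * T ∈ leftOpProducts F (prod F P P) := by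
  rintro _ ⟨_, ⟨a, ha, b, hb, rfl⟩, rfl⟩ _ ⟨_, ⟨c, hc, d, hd, rfl⟩, rfl⟩
  rw [← leftOp_mul]
  exact leftOp_mul_mem (mul_mem_prod ha hb) (mul_mem_prod hc hd)

/-- If `L` is solvable, then `L⁽ⁱ⁺¹⁾` acts nilpotently as soon as the products of pairs of elements
of `L⁽ⁱ⁾` do. -/
theorem isEngelSet_leftOpProducts (hsol : IsSolvable F L) {i : ℕ}
    (hnil : ∀ a ∈ derivedSeries F (⊤ : Submodule F L) i,
      ∀ b ∈ derivedSeries F (⊤ : Submodule F L) i, IsNilpotent (leftOp F (a * b))) :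
    IsEngelSet (leftOpProducts F (derivedSeries F (⊤ : Submodule F L) i)) := by
  have hanti : Antitone (derivedSeries F (⊤ : Submodule F L)) :=
    antitone_nat_of_succ_le derivedSeries_succ_le
  obtain ⟨n, hn⟩ := hsol
  rcases le_total n i with hni | hin
  · refine isEngelSet_of_subset_zero ?_
    rintro _ ⟨_, ⟨a, ha, b, -, rfl⟩, rfl⟩
    have ha0 : a = 0 := by
      have := hanti hni ha
      rwa [hn, Submodule.mem_bot] at this
    rw [ha0, zero_mul, leftOp_zero]
    rfl
  -- Start at the vanishing term `n` and descend to `i`, adjoining at each stage nilpotent operators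
  -- whose commutators come from the term just treated.
  · refine Nat.decreasingInduction'
      (P := fun j => IsEngelSet (leftOpProducts F (derivedSeries F (⊤ : Submodule F L) j)))
      (fun j _ hij ih => ?_) hin ?_
    · refine ih.of_isNilpotent (leftOpProducts_mono (derivedSeries_succ_le j))
        commutator_mem_leftOpProducts ?_
      rintro _ ⟨_, ⟨a, ha, b, hb, rfl⟩, rfl⟩
      exact hnil a (hanti hij ha) b (hanti hij hb)
    · refine isEngelSet_of_subset_zero ?_
      rintro _ ⟨_, ⟨a, ha, b, -, rfl⟩, rfl⟩
      have ha0 : a = 0 := by rwa [hn, Submodule.mem_bot] at ha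
      rw [ha0, zero_mul, leftOp_zero]
      rfl

omit [FiniteDimensional F L] in
theorem isNilpotent_leftOp_mul_of_adjoin_ne_top
    (htri : ∀ S : NonUnitalSubalgebra F L, IsTwoGenerated S → S ≠ ⊤ → IsLeftTriangulable S)
    {x y : L} (h : NonUnitalAlgebra.adjoin F {x, y} ≠ ⊤) : IsNilpotent (leftOp F (x * y)) :=
  isNilpotent_leftOp_mul_of_isLeftTriangulable (htri _ ⟨x, y, rfl⟩ h)
    (NonUnitalAlgebra.subset_adjoin F (by simp)) (NonUnitalAlgebra.subset_adjoin F (by simp))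

omit [FiniteDimensional F L] in
theorem isNilpotent_leftOp_mul_of_mem_derivedSeries (hsol : IsSolvable F L)
    (htri : ∀ S : NonUnitalSubalgebra F L, IsTwoGenerated S → S ≠ ⊤ → IsLeftTriangulable S)
    {a b : L} (ha : a ∈ derivedSeries F (⊤ : Submodule F L) 1)
    (hb : b ∈ derivedSeries F (⊤ : Submodule F L) 1) : IsNilpotent (leftOp F (a * b)) := by
  by_cases h : NonUnitalAlgebra.adjoin F {a, b} = ⊤
  · let P : NonUnitalSubalgebra F L :=
      { derivedSeries F (⊤ : Submodule F L) 1 with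
        mul_mem' := fun _ _ => mul_mem_prod Submodule.mem_top Submodule.mem_top }
    have hle : NonUnitalAlgebra.adjoin F {a, b} ≤ P := by
      rw [NonUnitalAlgebra.adjoin_le_iff]
      rintro z (rfl | rfl)
      exacts [ha, hb]
    have htop : derivedSeries F (⊤ : Submodule F L) 1 = ⊤ :=
      eq_top_iff.2 fun z _ => hle (h ▸ (trivial : z ∈ (⊤ : NonUnitalSubalgebra F L)))
    have hbot := top_eq_bot_of_isSolvable hsol htop
    have ha0 : a = 0 := by
      rw [← Submodule.mem_bot F, ← hbot]
      exact Submodule.mem_top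
    rw [ha0, zero_mul, leftOp_zero]
    exact IsNilpotent.zero
  · exact isNilpotent_leftOp_mul_of_adjoin_ne_top htri h

theorem isNilpotent_leftOp_mul (hsol : IsSolvable F L)
    (htri : ∀ S : NonUnitalSubalgebra F L, IsTwoGenerated S → S ≠ ⊤ → IsLeftTriangulable S)
    (x y : L) : IsNilpotent (leftOp F (x * y)) := by
  have hL2 : ∀ u v : L, u * v ∈ derivedSeries F (⊤ : Submodule F L) 1 :=
    fun u v => mul_mem_prod Submodule.mem_top Submodule.mem_top
  have hD : IsEngelSet (leftOpProducts F (derivedSeries F (⊤ : Submodule F L) 1)) :=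
    isEngelSet_leftOpProducts hsol fun a ha b hb =>
      isNilpotent_leftOp_mul_of_mem_derivedSeries hsol htri ha hb
  by_cases hE : engelSubalgebra F (x * y) = ⊤
  · obtain ⟨n, hn⟩ := isNilpotent_mulLeft_of_engelSubalgebra_eq_top F hE
    refine ⟨n, ?_⟩
    rw [leftOp_eq_baseChange, ← LinearMap.baseChange_pow, hn, LinearMap.baseChange_zero]
  · obtain ⟨x₀, hx₀, x₁, hx₁, hx⟩ := exists_add_mem_engelSubalgebra F (hL2 x y) x
    obtain ⟨y₀, hy₀, y₁, hy₁, hy⟩ := exists_add_mem_engelSubalgebra F (hL2 x y) y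
    have hnil₀ : IsNilpotent (leftOp F (x₀ * y₀)) := by
      refine isNilpotent_leftOp_mul_of_adjoin_ne_top htri fun h => hE (eq_top_iff.2 ?_)
      rw [← h, NonUnitalAlgebra.adjoin_le_iff]
      rintro z (rfl | rfl)
      exacts [hx₀, hy₀]
    -- One more nilpotent operator may join the Engel set of `L⁽¹⁾`: since `x₀ * y₀` is in `L⁽¹⁾`,
    -- all new commutators stay in that set.
    have hS : IsEngelSet (leftOp F '' insert (x₀ * y₀)
        {z | ∃ a ∈ derivedSeries F (⊤ : Submodule F L) 1,
          ∃ b ∈ derivedSeries F (⊤ : Submodule F L) 1, a * b = z}) := by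
      refine hD.of_isNilpotent (Set.image_mono (Set.subset_insert _ _)) ?_ ?_
      · have hmem : ∀ z ∈ insert (x₀ * y₀) {z | ∃ a ∈ derivedSeries F (⊤ : Submodule F L) 1,
            ∃ b ∈ derivedSeries F (⊤ : Submodule F L) 1, a * b = z},
            z ∈ derivedSeries F (⊤ : Submodule F L) 1 := by
          rintro z (rfl | ⟨a, -, b, -, rfl⟩)
          exacts [hL2 _ _, hL2 _ _]
        rintro _ ⟨u, hu, rfl⟩ _ ⟨v, hv, rfl⟩
        rw [← leftOp_mul]
        exact leftOp_mul_mem (hmem u hu) (hmem v hv)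
      · rintro _ ⟨z, rfl | ⟨a, ha, b, hb, rfl⟩, rfl⟩
        · exact hnil₀
        · exact isNilpotent_leftOp_mul_of_mem_derivedSeries hsol htri ha hb
    refine hS.isNilpotent_of_mem_span ?_
    have h2 : ∀ u ∈ derivedSeries F (⊤ : Submodule F L) 2,
        leftOp F u ∈ Submodule.span (AlgebraicClosure F) (leftOp F '' insert (x₀ * y₀)
          {z | ∃ a ∈ derivedSeries F (⊤ : Submodule F L) 1,
            ∃ b ∈ derivedSeries F (⊤ : Submodule F L) 1, a * b = z}) := fun u hu =>
      Submodule.span_mono (Set.image_mono (Set.subset_insert _ _)) (leftOp_mem_span F hu)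
    -- Here `xy = x₀y₀ + x₁y₀ + xy₁`, with `xy₁` in `L⁽²⁾`. Only left multiplication is known to
    -- preserve `L⁽²⁾`, so `x₁y₀` is traded for `-(y₀x₁)`, which has the same left operator.
    rw [← hy, mul_add, leftOp_add]
    refine Submodule.add_mem _ ?_ (h2 _ (mul_mem_derivedSeries_two x hy₁))
    rw [← hx, add_mul, leftOp_add]
    refine Submodule.add_mem _ (Submodule.subset_span ⟨_, Set.mem_insert _ _, rfl⟩) ?_
    rw [leftOp_mul_swap]
    exact h2 _ (Submodule.neg_mem _ (mul_mem_derivedSeries_two y₀ hx₁))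

omit [IsLeftLeibniz L] in
-- Left multiplication by `L²` lowers an Engel filtration of `K ⊗ L` by one step, so the `j`-th
-- lower central term of `L²` lies in `W (n - j)`.
theorem isStronglySolvable_of_isEngelSet
    (h : IsEngelSet (leftOpProducts F (⊤ : Submodule F L))) : IsStronglySolvable F L := by
  obtain ⟨n, W, h0, hn, hW⟩ := h.exists_filtration
  have hW' : ∀ i, ∀ a ∈ prod F (⊤ : Submodule F L) ⊤, ∀ v ∈ W (i + 1), leftOp F a v ∈ W i := by
    intro i a ha v hv
    have hT := leftOp_mem_span F (show a ∈ Submodule.span F _ from ha)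
    generalize leftOp F a = T at hT
    induction hT using Submodule.span_induction with
    | mem T hT => exact hW i T hT v hv
    | zero => exact (W i).zero_mem
    | add A B _ _ hA hB => exact (W i).add_mem hA hB
    | smul c A _ hA => exact (W i).smul_mem c hA
  have key : ∀ j ≤ n, ∀ a ∈ lowerCentralSeries F (prod F (⊤ : Submodule F L) ⊤) j,
      (1 : AlgebraicClosure F) ⊗ₜ[F] a ∈ W (n - j) := by
    intro j
    induction j with
    | zero => intro _ a _; rw [Nat.sub_zero, hn]; exact Submodule.mem_top
    | succ j ih =>
      intro hj a ha
      change a ∈ Submodule.span F _ at ha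
      induction ha using Submodule.span_induction with
      | mem z hz =>
        obtain ⟨p, hp, q, hq, rfl⟩ := hz
        rw [← leftOp_tmul]
        refine hW' _ p hp _ ?_
        rw [show n - (j + 1) + 1 = n - j by omega]
        exact ih (by omega) q hq
      | zero => rw [TensorProduct.tmul_zero]; exact Submodule.zero_mem _
      | add u v _ _ hu hv => rw [TensorProduct.tmul_add]; exact Submodule.add_mem _ hu hv
      | smul c u _ hu =>
        rw [TensorProduct.tmul_smul, ← algebraMap_smul (AlgebraicClosure F) c]
        exact Submodule.smul_mem _ _ hu
  refine ⟨n, (Submodule.eq_bot_iff _).2 fun a ha => ?_⟩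
  have := key n le_rfl a ha
  rw [Nat.sub_self, h0, Submodule.mem_bot] at this
  exact Module.FaithfullyFlat.tensorProduct_mk_injective (A := F) (B := AlgebraicClosure F) L
    (by simpa using this)

omit [FiniteDimensional F L] in
-- If `R_a = -L_a` on `U` modulo `W` for all `a`, left eigenvectors are right eigenvectors.
-- Otherwise the span `M` of all `(R_a + L_a) U` is not inside `W`, is stable under left
-- multiplications and is killed by right ones, so a left eigenvector in `W ⊔ M` modulo `W`
-- suffices.
theorem HasCommonEigenvectors.range_union_range
    (h : HasCommonEigenvectors (Set.range (leftOp F (L := L)))) :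
    HasCommonEigenvectors (Set.range (leftOp F (L := L)) ∪ Set.range (rightOp F)) := by
  intro W U hWU hW hU
  have hWL : ∀ a, ∀ v ∈ W, leftOp F a v ∈ W := fun a => hW _ (Or.inl ⟨a, rfl⟩)
  have hWR : ∀ a, ∀ v ∈ W, rightOp F a v ∈ W := fun a => hW _ (Or.inr ⟨a, rfl⟩)
  have hUL : ∀ a, ∀ v ∈ U, leftOp F a v ∈ U := fun a => hU _ (Or.inl ⟨a, rfl⟩)
  have hUR : ∀ a, ∀ v ∈ U, rightOp F a v ∈ U := fun a => hU _ (Or.inr ⟨a, rfl⟩)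
  have hWS : ∀ T ∈ Set.range (leftOp F (L := L)), ∀ v ∈ W, T v ∈ W := by
    rintro _ ⟨a, rfl⟩
    exact hWL a
  by_cases hskew : ∀ a : L, ∀ v ∈ U, rightOp F a v + leftOp F a v ∈ W
  · obtain ⟨v, hvU, hvW, hv⟩ := h W U hWU hWS (by rintro _ ⟨a, rfl⟩; exact hUL a)
    refine ⟨v, hvU, hvW, ?_⟩
    rintro _ (⟨a, rfl⟩ | ⟨a, rfl⟩)
    · exact hv _ ⟨a, rfl⟩
    · obtain ⟨c, hc⟩ := hv _ ⟨a, rfl⟩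
      refine ⟨-c, ?_⟩
      have := W.sub_mem (hskew a v hvU) hc
      rwa [add_sub_assoc, sub_sub_cancel, ← sub_neg_eq_add, ← neg_smul] at this
  · push Not at hskew
    obtain ⟨a₀, v₀, hv₀, hnot⟩ := hskew
    let M := Submodule.span (AlgebraicClosure F)
      {w | ∃ a : L, ∃ v ∈ U, rightOp F a v + leftOp F a v = w}
    have hMU : M ≤ U := by
      refine Submodule.span_le.2 ?_
      rintro _ ⟨a, v, hv, rfl⟩
      exact U.add_mem (hUR a v hv) (hUL a v hv)
    have hML : ∀ b, ∀ w ∈ M, leftOp F b w ∈ M := by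
      intro b w hw
      induction hw using Submodule.span_induction with
      | mem w hw =>
        obtain ⟨a, v, hv, rfl⟩ := hw
        have h1 : leftOp F b (rightOp F a v + leftOp F a v) =
            (rightOp F a (leftOp F b v) + leftOp F a (leftOp F b v)) +
              (rightOp F (b * a) v + leftOp F (b * a) v) := by
          rw [rightOp_mul, leftOp_mul]
          simp only [map_add, LinearMap.sub_apply, Module.End.mul_apply]
          abel
        rw [h1]
        exact M.add_mem (Submodule.subset_span ⟨a, _, hUL b v hv, rfl⟩)
          (Submodule.subset_span ⟨b * a, v, hv, rfl⟩)
      | zero => rw [map_zero]; exact M.zero_mem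
      | add u v _ _ hu hv => rw [map_add]; exact M.add_mem hu hv
      | smul c u _ hu => rw [map_smul]; exact M.smul_mem c hu
    have hMR : ∀ b, ∀ w ∈ M, rightOp F b w = 0 := by
      intro b w hw
      induction hw using Submodule.span_induction with
      | mem w hw =>
        obtain ⟨a, v, hv, rfl⟩ := hw
        exact LinearMap.congr_fun (rightOp_mul_rightOp_add_leftOp a b) v
      | zero => rw [map_zero]
      | add u v _ _ hu hv => rw [map_add, hu, hv, add_zero]
      | smul c u _ hu => rw [map_smul, hu, smul_zero]
    have hlt : W < W ⊔ M := by
      refine lt_of_le_of_ne le_sup_left fun heq => hnot ?_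
      rw [heq]
      exact Submodule.mem_sup_right (Submodule.subset_span ⟨a₀, v₀, hv₀, rfl⟩)
    obtain ⟨v, hvM, hvW, hv⟩ := h W (W ⊔ M) hlt hWS (by
      rintro _ ⟨a, rfl⟩ v hv
      obtain ⟨w, hw, m, hm, rfl⟩ := Submodule.mem_sup.1 hv
      rw [map_add]
      exact Submodule.add_mem_sup (hWL a w hw) (hML a m hm))
    refine ⟨v, sup_le hWU.le hMU hvM, hvW, ?_⟩
    rintro _ (⟨a, rfl⟩ | ⟨a, rfl⟩)
    · exact hv _ ⟨a, rfl⟩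
    · refine ⟨0, ?_⟩
      obtain ⟨w, hw, m, hm, rfl⟩ := Submodule.mem_sup.1 hvM
      rw [zero_smul, sub_zero, map_add, hMR a m hm, add_zero]
      exact hWR a w hw

omit [IsLeftLeibniz L] in
theorem isTriangulable_top_of_hasCommonEigenvectors
    (h : HasCommonEigenvectors (Set.range (leftOp F (L := L)) ∪ Set.range (rightOp F))) :
    IsTriangulable (⊤ : NonUnitalSubalgebra F L) := by
  obtain ⟨b, hb⟩ := h.exists_basis
  refine ⟨_, b, fun x hx => ?_⟩
  clear hx
  rw [blockTriangular_toMatrix_iff, blockTriangular_toMatrix_iff]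
  simp only [LinearMap.mulLeft_apply, LinearMap.mulRight_apply]
  induction x using TensorProduct.induction_on with
  | zero => simp
  | tmul c a =>
    have hc : c ⊗ₜ[F] a = c • ((1 : AlgebraicClosure F) ⊗ₜ[F] a) := by
      rw [TensorProduct.smul_tmul', smul_eq_mul, mul_one]
    rw [hc]
    constructor
    · intro j
      rw [smul_mul_assoc]
      exact Submodule.smul_mem _ c (hb _ (Or.inl ⟨a, rfl⟩) j)
    · intro j
      rw [mul_smul_comm]
      exact Submodule.smul_mem _ c (hb _ (Or.inr ⟨a, rfl⟩) j)
  | add x y hx hy =>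
    constructor
    · intro j
      rw [add_mul]
      exact Submodule.add_mem _ (hx.1 j) (hy.1 j)
    · intro j
      rw [mul_add]
      exact Submodule.add_mem _ (hx.2 j) (hy.2 j)

end Main

end Leibniz

theorem mainTheorem5 {F : Type*} [Field F] {L : Type*} [NonUnitalNonAssocRing L] [Module F L]
    [IsScalarTower F L L] [SMulCommClass F L L] [IsLeftLeibniz L] [FiniteDimensional F L]
    (hsol : Leibniz.IsSolvable F L)
    (htri : ∀ S : NonUnitalSubalgebra F L, Leibniz.IsTwoGenerated S → S ≠ ⊤ →
      Leibniz.IsLeftTriangulable S) :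
    Leibniz.IsTriangulable (⊤ : NonUnitalSubalgebra F L) ∧ Leibniz.IsStronglySolvable F L := by
  have hE : Leibniz.IsEngelSet (Leibniz.leftOpProducts F (⊤ : Submodule F L)) :=
    Leibniz.isEngelSet_leftOpProducts (i := 0) hsol fun a _ b _ =>
      Leibniz.isNilpotent_leftOp_mul hsol htri a b
  refine ⟨Leibniz.isTriangulable_top_of_hasCommonEigenvectors ?_,
    Leibniz.isStronglySolvable_of_isEngelSet hE⟩
  refine Leibniz.HasCommonEigenvectors.range_union_range (hE.hasCommonEigenvectors ?_ ?_)
  · rintro _ ⟨z, -, rfl⟩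
    exact ⟨z, rfl⟩
  · rintro _ ⟨a, rfl⟩ _ ⟨b, rfl⟩
    rw [← Leibniz.leftOp_mul]
    exact Leibniz.leftOp_mul_mem Submodule.mem_top Submodule.mem_top
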